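/- All tensors are over $\mathbb{C}$. A tensor $\psi\in V_1\otimes V_2\otimes V_3$ \emph{restricts} to $\phi\in W_1\otimes W_2\otimes W_3$, written $\psi\ge\phi$, if there are linear maps $A_j:V_j\to W_j$ with $(A_1\otimes A_2\otimes A_3)\psi=\phi$. Let $$\mathrm{GHZ}_k=\sum_{i=1}^k |i\rangle\otimes|i\rangle\otimes|i\rangle ,\qquad \mathrm{MaMu}_3(n)=\sum_{i_1,i_2,i_3=1}^n |i_3 i_1\rangle\otimes|i_1 i_2\rangle\otimes|i_2 i_3\rangle ,$$ and let $\mathrm{bond}(\phi)=\min\{D\in\mathbb{N} : \mathrm{MaMu}_3(D)\ge\phi\}$ be the (MPS) bond dimension of a 3-party tensor $\phi$. \textbf{Proposition.} (1) For every integer $k\ge 2$, $\ \frac12\bigl(1+\sqrt{4k-3}\bigr)<\mathrm{bond}(\mathrm{GHZ}_k)$. (2) There is a constant $c>0$ such that $\mathrm{bond}(\mathrm{GHZ}_k)=O\bigl(k^{\frac12+c/\sqrt{\log k}}\bigr)$ as $k\to\infty$. (3) For every integer $n\ge 2$, $\mathrm{MaMu}_3(n)$ does not restrict to $\mathrm{GHZ}_{n^2-n+1}$.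 (4) There are a constant $c'>0$ and a function $f:\mathbb{N}\to\mathbb{N}$ such that $\mathrm{MaMu}_3(n)\ge\mathrm{GHZ}_{f(n)}$ for every $n\ge1$, and $f(n)=\Theta\bigl((n^2)^{1-c'/\sqrt{\log n}}\bigr)$ as $n\to\infty$. -/

import Mathlib

open scoped TensorProduct

noncomputable section

/-- The tensor `ψ ∈ V₁ ⊗ ⋯ ⊗ V_m` restricts to `φ ∈ W₁ ⊗ ⋯ ⊗ W_m` if there are local linear maps
`A_j : V_j → W_j` with `(A₁ ⊗ ⋯ ⊗ A_m) ψ = φ`. -/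
def Restricts {m : ℕ} {V W : Fin m → Type*}
    [∀ j, AddCommGroup (V j)] [∀ j, Module ℂ (V j)]
    [∀ j, AddCommGroup (W j)] [∀ j, Module ℂ (W j)]
    (ψ : ⨂[ℂ] j, V j) (φ : ⨂[ℂ] j, W j) : Prop :=
  ∃ A : ∀ j, V j →ₗ[ℂ] W j, PiTensorProduct.map A ψ = φ

/-- The standard basis vector `|i⟩` of the space with basis indexed by `ι`. -/
def ket {ι : Type*} [DecidableEq ι] (i : ι) : ι → ℂ := Pi.single i 1

/-- The `k`-level GHZ tensor on `m` parties, `∑ i, |i⟩ ⊗ ⋯ ⊗ |i⟩`. -/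
def ghz (m k : ℕ) : ⨂[ℂ] _j : Fin m, (Fin k → ℂ) :=
  ∑ i : Fin k, ⨂ₜ[ℂ] _j : Fin m, ket i

/-- The (iterated) matrix multiplication tensor on `m` parties arranged in a cycle,
`∑ i₁ … i_m, |i_m i₁⟩ ⊗ |i₁ i₂⟩ ⊗ ⋯ ⊗ |i_{m-1} i_m⟩`, all indices ranging over `D` values.
Here `(finRotate m).symm j` is the cyclic predecessor of `j`, and
`ℂ^D ⊗ ℂ^D` is realised as the space with basis `|a b⟩`, `(a, b) ∈ Fin D × Fin D`. -/
def mamu (m D : ℕ) : ⨂[ℂ] _j : Fin m, (Fin D × Fin D → ℂ) :=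
  ∑ i : Fin m → Fin D, ⨂ₜ[ℂ] j : Fin m, ket (i ((finRotate m).symm j), i j)

/-- The (MPS) bond dimension of a tensor on `m` parties: the least `D` such that the matrix
multiplication tensor `mamu m D` restricts to it. -/
def bondDim {m : ℕ} {W : Fin m → Type*} [∀ j, AddCommGroup (W j)] [∀ j, Module ℂ (W j)]
    (φ : ⨂[ℂ] j, W j) : ℕ :=
  sInf {D : ℕ | Restricts (mamu m D) φ}

end

/-! In coordinates, a restriction to GHZ is three families of matrices with tr(A_r B_s C_t) = 1 if r
= s = t and 0 otherwise. Let N be the annihilator of the C_t under the trace pairing: A_r B_s lies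
in N exactly when r ≠ s.

For the obstruction take k = n² - n + 1, so that span A has codimension n - 1 and dim N = n - 1.
Dimension counts force B_s = w_s x_sᵀ (`exists_eq_vecMulVec`) and then N ⊆ {y x_{s₀}ᵀ} for a single
s₀ (`exists_ker_eq_vecMulVec`). Since k > n, the w_s satisfy a linear relation; `card_add_ne` shows
that it has only one nonzero coefficient, so some w_i = 0, which is absurd. The lower bound on bond
dimension follows by solving k ≤ D² - D.

Conversely, a family of triangles in a tripartite graph whose edges close up to no further triangle
gives a restriction (`restricts_of_triangles`). Ruzsa–Szemerédi triangles over Behrend's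
progression-free sets supply n² exp(-O(√log n)) of them. -/

/-! ### Restrictions in coordinates -/

theorem repr_map_mamu {n k : ℕ} (A : Fin 3 → (Fin n × Fin n → ℂ) →ₗ[ℂ] (Fin k → ℂ))
    (p : Fin 3 → Fin k) :
    (Basis.piTensorProduct fun _ : Fin 3 => Pi.basisFun ℂ (Fin k)).repr
        (PiTensorProduct.map A (mamu 3 n)) p =
      ∑ i : Fin 3 → Fin n, A 0 (ket (i 2, i 0)) (p 0) * A 1 (ket (i 0, i 1)) (p 1) *
        A 2 (ket (i 1, i 2)) (p 2) := by
  have h0 : (finRotate 3).symm 0 = 2 := by decide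
  have h1 : (finRotate 3).symm 1 = 0 := by decide
  have h2 : (finRotate 3).symm 2 = 1 := by decide
  simp only [mamu, map_sum, PiTensorProduct.map_tprod, Finsupp.finsetSum_apply,
    Basis.piTensorProduct_repr_tprod_apply, Fin.prod_univ_three, Pi.basisFun_repr, h0, h1, h2]

theorem repr_ghz {k : ℕ} (p : Fin 3 → Fin k) :
    (Basis.piTensorProduct fun _ : Fin 3 => Pi.basisFun ℂ (Fin k)).repr (ghz 3 k) p =
      if p 0 = p 1 ∧ p 1 = p 2 then 1 else 0 := by
  simp only [ghz, map_sum, Finsupp.finsetSum_apply,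
    Basis.piTensorProduct_repr_tprod_apply, Fin.prod_univ_three, Pi.basisFun_repr, ket,
    Pi.single_apply]
  rw [Finset.sum_eq_single (p 0)]
  · by_cases h1 : p 0 = p 1 <;> by_cases h2 : p 1 = p 2 <;> simp_all [eq_comm]
  · intro b _ hb
    simp [hb.symm]
  · simp

/-- Coordinate form of the restriction of the matrix multiplication tensor to a GHZ tensor. -/
theorem restricts_mamu_ghz_iff {n k : ℕ} :
    Restricts (mamu 3 n) (ghz 3 k) ↔
      ∃ A : Fin 3 → (Fin n × Fin n → ℂ) →ₗ[ℂ] (Fin k → ℂ), ∀ p : Fin 3 → Fin k,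
        ∑ i : Fin 3 → Fin n, A 0 (ket (i 2, i 0)) (p 0) * A 1 (ket (i 0, i 1)) (p 1) *
          A 2 (ket (i 1, i 2)) (p 2) = if p 0 = p 1 ∧ p 1 = p 2 then 1 else 0 := by
  refine exists_congr fun A => ?_
  rw [← (Basis.piTensorProduct fun _ : Fin 3 => Pi.basisFun ℂ (Fin k)).repr.injective.eq_iff,
    DFunLike.ext_iff]
  exact forall_congr' fun p => by rw [repr_map_mamu, repr_ghz]

/-- A restriction of `mamu 3 n` to `ghz 3 k` gives matrices whose triple trace products are
Kronecker deltas. -/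
theorem exists_matrix_of_restricts {n k : ℕ} (h : Restricts (mamu 3 n) (ghz 3 k)) :
    ∃ A B C : Fin k → Matrix (Fin n) (Fin n) ℂ, ∀ r s t,
      (A r * B s * C t).trace = if r = s ∧ s = t then 1 else 0 := by
  obtain ⟨F, hF⟩ := restricts_mamu_ghz_iff.1 h
  refine ⟨fun r => .of fun a b => F 0 (ket (a, b)) r, fun r => .of fun a b => F 1 (ket (a, b)) r,
    fun r => .of fun a b => F 2 (ket (a, b)) r, fun r s t => ?_⟩
  have := hF ![r, s, t]
  simp only [Matrix.cons_val] at this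
  refine Eq.trans ?_ this
  let e : (Fin n × Fin n × Fin n) ≃ (Fin 3 → Fin n) :=
    { toFun := fun p => ![p.2.2, p.2.1, p.1]
      invFun := fun i => (i 2, i 1, i 0)
      left_inv := fun p => rfl
      right_inv := fun i => by ext j; fin_cases j <;> rfl }
  rw [← e.sum_comp]
  simp only [Fintype.sum_prod_type, Matrix.trace, Matrix.diag, Matrix.mul_apply,
    Finset.sum_mul, Matrix.of_apply]
  rfl

/-- Triples of edges that close up to a triangle only if they come from the same triangle give a
restriction to a GHZ tensor. -/
theorem restricts_of_triangles {n k : ℕ} (x y z : Fin k → Fin n)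
    (h : ∀ r s t, x r = x t → y r = y s → z s = z t → r = s ∧ s = t) :
    Restricts (mamu 3 n) (ghz 3 k) := by
  refine restricts_mamu_ghz_iff.2 ⟨![LinearMap.funLeft ℂ ℂ fun r => (x r, y r),
    LinearMap.funLeft ℂ ℂ fun r => (y r, z r), LinearMap.funLeft ℂ ℂ fun r => (z r, x r)],
    fun p => ?_⟩
  simp only [Matrix.cons_val, LinearMap.funLeft_apply, ket, Pi.single_apply, Prod.mk.injEq]
  split_ifs with hp
  · rw [Finset.sum_eq_single ![y (p 0), z (p 0), x (p 0)]]
    · simp [hp.1, hp.2]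
    · intro i _ hi
      by_contra hne
      simp only [mul_ite, mul_one, mul_zero, ite_eq_right_iff] at hne
      push Not at hne
      apply hi
      ext j
      fin_cases j <;> simp <;> grind
    · simp
  · refine Finset.sum_eq_zero fun i _ => ?_
    by_contra hne
    simp only [mul_ite, mul_one, mul_zero, ite_eq_right_iff] at hne
    push Not at hne
    exact hp (h _ _ _ (by grind) (by grind) (by grind))

/-! ### Linear algebra of trace-dual families: k = n² - n + 1 is impossible -/

section
open Module

/-- Codimension does not grow under a surjection. This drives all the dimension counts below. -/
theorem finrank_add_finrank_le_of_surjective {K E F : Type*} [Field K] [AddCommGroup E]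
    [Module K E] [FiniteDimensional K E] [AddCommGroup F] [Module K F] {f : E →ₗ[K] F}
    (hf : Function.Surjective f) (V : Submodule K E) :
    finrank K F + finrank K V ≤ finrank K (V.map f) + finrank K E := by
  have h1 := (f.domRestrict V).finrank_range_add_finrank_ker
  have h2 := f.finrank_range_add_finrank_ker
  rw [LinearMap.range_domRestrict] at h1
  rw [LinearMap.range_eq_top.2 hf, finrank_top] at h2
  have h3 : finrank K (LinearMap.ker (f.domRestrict V)) ≤ finrank K (LinearMap.ker f) := by
    refine LinearMap.finrank_le_finrank_of_injective
      (f := (V.subtype ∘ₗ (LinearMap.ker (f.domRestrict V)).subtype).codRestrict _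
        fun x => x.2) ?_
    intro x y hxy
    have hval : ((x : V) : E) = (y : V) := congrArg (fun z : LinearMap.ker f => (z : E)) hxy
    exact Subtype.ext (Subtype.ext hval)
  omega

namespace Matrix

variable {K : Type*} [Field K] {n : ℕ}

/-- Evaluation of matrices at a family of vectors. -/
def evalVecs {κ : Type*} (w : κ → Fin n → K) :
    Matrix (Fin n) (Fin n) K →ₗ[K] (κ → Fin n → K) :=
  LinearMap.pi fun i => (mulVecBilin K K).flip (w i)

@[simp]
theorem evalVecs_apply {κ : Type*} (w : κ → Fin n → K) (M : Matrix (Fin n) (Fin n) K) (i : κ) :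
    evalVecs w M i = M *ᵥ w i := rfl

theorem evalVecs_surjective {κ : Type*} {w : κ → Fin n → K} (hw : LinearIndependent K w) :
    Function.Surjective (evalVecs w) := by
  intro y
  obtain ⟨g, hg⟩ := LinearMap.exists_extend ((Basis.span hw).constr K y)
  refine ⟨LinearMap.toMatrix' g, funext fun i => ?_⟩
  rw [evalVecs_apply, ← Matrix.toLin'_apply, Matrix.toLin'_toMatrix']
  have := LinearMap.congr_fun hg (Basis.span hw i)
  rw [Basis.constr_basis] at this
  simpa [Basis.span_apply] using this

theorem finrank_square : finrank K (Matrix (Fin n) (Fin n) K) = n ^ 2 := by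
  simp [Module.finrank_matrix, sq]

theorem smul_eq_of_vecMulVec_eq {u y x x' : Fin n → K} (hu : u ≠ 0)
    (h : vecMulVec u x' = vecMulVec y x) : ∃ c : K, x' = c • x := by
  obtain ⟨i, hi⟩ := Function.ne_iff.1 hu
  refine ⟨y i / u i, funext fun j => ?_⟩
  have := congrFun (congrFun h i) j
  simp only [vecMulVec_apply] at this
  simp only [Pi.zero_apply] at hi
  simp only [Pi.smul_apply, smul_eq_mul]
  field_simp
  linear_combination this

/-- If any two vectors in the range of `B` are dependent then `B` is an outer product. -/
theorem exists_vecMulVec_eq {B : Matrix (Fin n) (Fin n) K}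
    (h : ∀ p q, ¬ LinearIndependent K ![B *ᵥ p, B *ᵥ q]) : ∃ w x, B = vecMulVec w x := by
  by_cases hB : B = 0
  · exact ⟨0, 0, by simp [hB]⟩
  obtain ⟨j, hj⟩ : ∃ j, B *ᵥ Pi.single j 1 ≠ 0 := by
    by_contra! hc
    exact hB (by ext i j; simpa using congrFun (hc j) i)
  have : ∀ q, ∃ c : K, c • (B *ᵥ Pi.single j 1) = B *ᵥ q := by
    intro q
    by_contra! hc
    exact h _ _ ((LinearIndependent.pair_iff' hj).2 hc)
  choose c hc using this
  refine ⟨B *ᵥ Pi.single j 1, fun l => c (Pi.single l 1), ?_⟩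
  ext i l
  have := congrFun (hc (Pi.single l 1)) i
  simp at this
  simp [vecMulVec_apply, ← this, mul_comm]

variable {ι : Type*} {A B C : ι → Matrix (Fin n) (Fin n) K}

/-- The triple trace products of three families of matrices are Kronecker deltas. -/
def TraceDual [DecidableEq ι] (A B C : ι → Matrix (Fin n) (Fin n) K) : Prop :=
  ∀ r s t, (A r * B s * C t).trace = if r = s ∧ s = t then 1 else 0

/-- The linear map pairing a matrix with the family `C`. -/
def tracePairing (C : ι → Matrix (Fin n) (Fin n) K) : Matrix (Fin n) (Fin n) K →ₗ[K] (ι → K) :=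
  LinearMap.pi fun t => traceLinearMap (Fin n) K K ∘ₗ LinearMap.mulRight K (C t)

@[simp]
theorem tracePairing_apply (M : Matrix (Fin n) (Fin n) K) (t : ι) :
    tracePairing C M t = (M * C t).trace := rfl

namespace TraceDual

variable [DecidableEq ι]

theorem rotate (h : TraceDual A B C) : TraceDual B C A := by
  intro r s t
  rw [trace_mul_cycle, h]
  grind

theorem tracePairing_mul (h : TraceDual A B C) (s : ι) :
    tracePairing C (A s * B s) = Pi.single s 1 := by
  ext t
  simp [h s s t, Pi.single_apply, eq_comm]

theorem mul_mem_ker (h : TraceDual A B C) {r s : ι} (hrs : r ≠ s) :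
    A r * B s ∈ LinearMap.ker (tracePairing C) := by
  rw [LinearMap.mem_ker]
  ext t
  simp [h r s t, hrs]

theorem mul_notMem_ker (h : TraceDual A B C) (s : ι) :
    A s * B s ∉ LinearMap.ker (tracePairing C) := by
  rw [LinearMap.mem_ker, h.tracePairing_mul]
  simp

/-- Only the product with r = s leaves the kernel. -/
theorem finrank_map_mulRight_le (h : TraceDual A B C) (s : ι) :
    finrank K ((Submodule.span K (Set.range A)).map (LinearMap.mulRight K (B s))) ≤
      finrank K (LinearMap.ker (tracePairing C)) + 1 := by
  have hle : (Submodule.span K (Set.range A)).map (LinearMap.mulRight K (B s)) ≤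
      LinearMap.ker (tracePairing C) ⊔ Submodule.span K {A s * B s} := by
    rw [Submodule.map_span, Submodule.span_le]
    rintro _ ⟨_, ⟨r, rfl⟩, rfl⟩
    rw [LinearMap.mulRight_apply]
    by_cases hrs : r = s
    · subst hrs
      exact Submodule.mem_sup_right (Submodule.mem_span_singleton_self _)
    · exact Submodule.mem_sup_left (h.mul_mem_ker hrs)
  refine (Submodule.finrank_mono hle).trans
    ((Submodule.finrank_add_le_finrank_add_finrank _ _).trans ?_)
  gcongr
  exact (finrank_span_le_card _).trans (by simp)

variable [Fintype ι]

theorem linearIndependent (h : TraceDual A B C) : LinearIndependent K A := by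
  rw [Fintype.linearIndependent_iff]
  intro g hg s
  have := congrArg (fun M => (M * (B s * C s)).trace) hg
  simp only [Finset.sum_mul, smul_mul_assoc, trace_sum, trace_smul, ← Matrix.mul_assoc, h _ s s,
    and_true, zero_mul, trace_zero] at this
  simpa using this

theorem finrank_span (h : TraceDual A B C) :
    finrank K (Submodule.span K (Set.range A)) = Fintype.card ι :=
  finrank_span_eq_card h.linearIndependent

theorem finrank_ker_add (h : TraceDual A B C) :
    finrank K (LinearMap.ker (tracePairing C)) + Fintype.card ι = n ^ 2 := by
  have hs : LinearMap.range (tracePairing C) = ⊤ := by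
    rw [eq_top_iff, ← (Pi.basisFun K ι).span_eq, Submodule.span_le]
    rintro _ ⟨s, rfl⟩
    exact ⟨A s * B s, by simp [h.tracePairing_mul]⟩
  have := (tracePairing C).finrank_range_add_finrank_ker
  rw [hs, finrank_top, finrank_square, finrank_fintype_fun_eq_card] at this
  omega

theorem card_le (h : TraceDual A B C) : Fintype.card ι ≤ n ^ 2 := by
  have := h.finrank_ker_add
  omega

/-- If B_s had rank at least 2, evaluating span A at two independent vectors of its range would give
dimension at least 2n - (n - 1) = n + 1. That evaluation factors through (span A) B_s, of dimension
at most n. -/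
theorem exists_eq_vecMulVec (h : TraceDual A B C) (hk : Fintype.card ι + n = n ^ 2 + 1)
    (s : ι) : ∃ w x, B s = vecMulVec w x := by
  refine exists_vecMulVec_eq fun p q hpq => ?_
  have h1 : finrank K (Fin 2 → Fin n → K) + _ ≤ _ :=
    finrank_add_finrank_le_of_surjective (evalVecs_surjective hpq)
      (Submodule.span K (Set.range A))
  have h2 : evalVecs ![B s *ᵥ p, B s *ᵥ q] = evalVecs ![p, q] ∘ₗ LinearMap.mulRight K (B s) := by
    ext1 M
    ext i j
    fin_cases i <;> simp
  rw [h2, Submodule.map_comp, h.finrank_span, finrank_square] at h1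
  have h3 := Submodule.finrank_map_le (evalVecs ![p, q])
    ((Submodule.span K (Set.range A)).map (LinearMap.mulRight K (B s)))
  have h4 := h.finrank_map_mulRight_le s
  have h5 := h.finrank_ker_add
  have h6 : finrank K (Fin 2 → Fin n → K) = 2 * n := by
    simp [Module.finrank_pi_fintype]
  omega

variable {w x : ι → Fin n → K}

/-- A nonzero μ orthogonal to every w_s would satisfy μᵀ B_s = 0, which is n independent conditions
on span B, of codimension n - 1. -/
theorem span_left_eq_top (h : TraceDual A B C) (hk : Fintype.card ι + n = n ^ 2 + 1)
    (hB : ∀ s, B s = vecMulVec (w s) (x s)) : Submodule.span K (Set.range w) = ⊤ := by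
  by_contra hne
  obtain ⟨f, hf, hfw⟩ := Submodule.exists_dual_map_eq_bot_of_lt_top (lt_top_iff_ne_top.2 hne)
    inferInstance
  obtain ⟨μ, rfl⟩ := (dotProductEquiv K (Fin n)).surjective f
  have hμ : μ ≠ 0 := by rintro rfl; simp at hf
  have hw : ∀ s, μ ⬝ᵥ w s = 0 := fun s => by
    have : dotProductEquiv K (Fin n) μ (w s) ∈
        (Submodule.span K (Set.range w)).map (dotProductEquiv K (Fin n) μ) :=
      Submodule.mem_map_of_mem (Submodule.subset_span ⟨s, rfl⟩)
    rw [hfw] at this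
    simpa using this
  have hli : LinearIndependent K fun _ : Unit => μ := linearIndependent_unique_iff.2 hμ
  have hsurj : Function.Surjective
      (evalVecs (fun _ : Unit => μ) ∘ₗ (transposeLinearEquiv (Fin n) (Fin n) K K).toLinearMap) :=
    (evalVecs_surjective hli).comp (LinearEquiv.surjective _)
  have h1 := finrank_add_finrank_le_of_surjective hsurj (Submodule.span K (Set.range B))
  have h2 : (Submodule.span K (Set.range B)).map
      (evalVecs (fun _ : Unit => μ) ∘ₗ (transposeLinearEquiv (Fin n) (Fin n) K K).toLinearMap)
        = ⊥ := by
    rw [Submodule.map_span, Submodule.span_eq_bot]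
    rintro _ ⟨_, ⟨s, rfl⟩, rfl⟩
    ext i j
    simp [hB, vecMulVec_mulVec, dotProduct_comm, hw]
  rw [h2, finrank_bot, h.rotate.finrank_span, finrank_square] at h1
  have h6 : finrank K (Unit → Fin n → K) = n := by simp [Module.finrank_pi_fintype]
  omega

/-- Otherwise each s has a μ_s ≠ 0 with μ_sᵀ A_r w_s = 0 for all r. Over a basis chosen among the
w_s these are n independent conditions on span A, of codimension n - 1. -/
theorem exists_map_evalVecs_eq_top (h : TraceDual A B C)
    (hk : Fintype.card ι + n = n ^ 2 + 1) (hB : ∀ s, B s = vecMulVec (w s) (x s)) :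
    ∃ s, (Submodule.span K (Set.range A)).map ((mulVecBilin K K).flip (w s)) = ⊤ := by
  by_contra! hne
  have hμ : ∀ s, ∃ μ : Fin n → K, μ ≠ 0 ∧ ∀ r, μ ⬝ᵥ (A r *ᵥ w s) = 0 := by
    intro s
    obtain ⟨f, hf, hfw⟩ := Submodule.exists_dual_map_eq_bot_of_lt_top
      (lt_top_iff_ne_top.2 (hne s)) inferInstance
    obtain ⟨μ, rfl⟩ := (dotProductEquiv K (Fin n)).surjective f
    refine ⟨μ, by rintro rfl; simp at hf, fun r => ?_⟩
    have : dotProductEquiv K (Fin n) μ (A r *ᵥ w s) ∈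
        ((Submodule.span K (Set.range A)).map ((mulVecBilin K K).flip (w s))).map
          (dotProductEquiv K (Fin n) μ) :=
      Submodule.mem_map_of_mem (Submodule.mem_map_of_mem (Submodule.subset_span ⟨r, rfl⟩))
    rw [hfw] at this
    simpa using this
  choose μ hμ0 hμ using hμ
  obtain ⟨κ, a, ha, hspan, hli⟩ := exists_linearIndependent' K w
  have : Fintype κ := Fintype.ofInjective a ha
  have hcard : Fintype.card κ = n := by
    rw [← finrank_span_eq_card hli, hspan, h.span_left_eq_top hk hB, finrank_top]
    simp
  have hsurj : Function.Surjective
      (LinearMap.pi (fun i => dotProductEquiv K (Fin n) (μ (a i)) ∘ₗ LinearMap.proj i) ∘ₗ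
        evalVecs (w ∘ a)) := by
    rw [LinearMap.coe_comp]
    refine Function.Surjective.comp (fun y => ?_) (evalVecs_surjective hli)
    have : ∀ i, ∃ v : Fin n → K, μ (a i) ⬝ᵥ v = y i := fun i => by
      obtain ⟨j, hj⟩ := Function.ne_iff.1 (hμ0 (a i))
      exact ⟨Pi.single j (y i / μ (a i) j), by
        rw [dotProduct_single, mul_div_cancel₀ _ hj]⟩
    choose v hv using this
    exact ⟨v, funext fun i => by simp [hv]⟩
  have h1 := finrank_add_finrank_le_of_surjective hsurj (Submodule.span K (Set.range A))
  have h2 : (Submodule.span K (Set.range A)).map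
      (LinearMap.pi (fun i => dotProductEquiv K (Fin n) (μ (a i)) ∘ₗ LinearMap.proj i) ∘ₗ
        evalVecs (w ∘ a)) = ⊥ := by
    rw [Submodule.map_span, Submodule.span_eq_bot]
    rintro _ ⟨_, ⟨s, rfl⟩, rfl⟩
    ext i
    simp [hμ]
  rw [h2, finrank_bot, h.finrank_span, finrank_square, finrank_fintype_fun_eq_card, hcard] at h1
  omega

theorem exists_ker_eq_vecMulVec (h : TraceDual A B C)
    (hk : Fintype.card ι + n = n ^ 2 + 1) (hB : ∀ s, B s = vecMulVec (w s) (x s)) :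
    ∃ s, ∀ M ∈ LinearMap.ker (tracePairing C), ∃ y, M = vecMulVec y (x s) := by
  obtain ⟨s, hs⟩ := h.exists_map_evalVecs_eq_top hk hB
  refine ⟨s, ?_⟩
  have hx : x s ≠ 0 := fun h0 => h.mul_notMem_ker s (by simp [hB, h0])
  obtain ⟨j, hj⟩ := Function.ne_iff.1 hx
  let X := Submodule.span K ((fun r => A r *ᵥ w s) '' {s}ᶜ)
  let f : (Fin n → K) →ₗ[K] Matrix (Fin n) (Fin n) K := (vecMulVecBilin K K).flip (x s)
  have hf : Function.Injective f := by
    intro y z hyz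
    ext i
    have := congrFun (congrFun hyz i) j
    exact mul_right_cancel₀ hj this
  have hX : n ≤ finrank K X + 1 := by
    have hle : (Submodule.span K (Set.range A)).map ((mulVecBilin K K).flip (w s)) ≤
        X ⊔ Submodule.span K {A s *ᵥ w s} := by
      rw [Submodule.map_span, Submodule.span_le]
      rintro _ ⟨_, ⟨r, rfl⟩, rfl⟩
      by_cases hrs : r = s
      · subst hrs
        exact Submodule.mem_sup_right (Submodule.mem_span_singleton_self _)
      · exact Submodule.mem_sup_left (Submodule.subset_span ⟨r, hrs, rfl⟩)
    have h1 := Submodule.finrank_mono hle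
    have h2 := Submodule.finrank_add_le_finrank_add_finrank X (Submodule.span K {A s *ᵥ w s})
    have h3 : finrank K (Submodule.span K {A s *ᵥ w s}) ≤ 1 :=
      (finrank_span_le_card _).trans (by simp)
    rw [hs, finrank_top, finrank_fintype_fun_eq_card, Fintype.card_fin] at h1
    omega
  have hXN : X.map f ≤ LinearMap.ker (tracePairing C) := by
    rw [Submodule.map_span, Submodule.span_le]
    rintro _ ⟨_, ⟨r, hr, rfl⟩, rfl⟩
    have := h.mul_mem_ker hr
    rwa [hB, mul_vecMulVec] at this
  -- Both sides have dimension n - 1.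
  have heq : X.map f = LinearMap.ker (tracePairing C) := by
    refine Submodule.eq_of_le_of_finrank_le hXN ?_
    rw [← (Submodule.equivMapOfInjective f hf X).finrank_eq]
    have := h.finrank_ker_add
    omega
  rw [← heq]
  rintro _ ⟨y, -, rfl⟩
  exact ⟨y, rfl⟩

/-- For independent w_s, w_t, evaluation at the pair maps span A into dimension at most 2, but the
image has dimension at least n + 1. For dependent ones, A_t w_t would vanish. -/
theorem eq_of_mulVec_eq_zero (h : TraceDual A B C) (hk : Fintype.card ι + n = n ^ 2 + 1)
    (hn : 2 ≤ n) (hB : ∀ s, B s = vecMulVec (w s) (x s)) {s t : ι}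
    (hs : ∀ r, r ≠ s → A r *ᵥ w s = 0) (ht : ∀ r, r ≠ t → A r *ᵥ w t = 0) : s = t := by
  by_contra hst
  have hne : ∀ r, A r *ᵥ w r ≠ 0 := fun r h0 =>
    h.mul_notMem_ker r (by rw [hB, mul_vecMulVec, h0]; simp)
  by_cases hli : LinearIndependent K ![w s, w t]
  · have h1 : finrank K (Fin 2 → Fin n → K) + _ ≤ _ := finrank_add_finrank_le_of_surjective
      (evalVecs_surjective hli) (Submodule.span K (Set.range A))
    obtain ⟨p, hp⟩ : ∃ p : Fin 2 → Fin n → K, p = ![A s *ᵥ w s, 0] := ⟨_, rfl⟩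
    obtain ⟨q, hq⟩ : ∃ q : Fin 2 → Fin n → K, q = ![0, A t *ᵥ w t] := ⟨_, rfl⟩
    have h2 : (Submodule.span K (Set.range A)).map (evalVecs (κ := Fin 2) ![w s, w t]) ≤
        Submodule.span K {p} ⊔ Submodule.span K {q} := by
      rw [Submodule.map_span, Submodule.span_le]
      rintro _ ⟨_, ⟨r, rfl⟩, rfl⟩
      by_cases hrs : r = s
      · subst hrs
        refine Submodule.mem_sup_left (Submodule.mem_span_singleton.2 ⟨1, ?_⟩)
        ext i j
        fin_cases i <;> simp [hp, ht r hst]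
      by_cases hrt : r = t
      · subst hrt
        refine Submodule.mem_sup_right (Submodule.mem_span_singleton.2 ⟨1, ?_⟩)
        ext i j
        fin_cases i <;> simp [hq, hs r hrs]
      · have : evalVecs (κ := Fin 2) ![w s, w t] (A r) = 0 := by
          ext i j
          fin_cases i <;> simp [hs r hrs, ht r hrt]
        rw [this]
        exact Submodule.zero_mem _
    have h3 := (Submodule.finrank_mono h2).trans
      (Submodule.finrank_add_le_finrank_add_finrank _ _)
    have h4 : finrank K (Submodule.span K {p}) ≤ 1 :=
      (finrank_span_le_card _).trans (by simp)
    have h5 : finrank K (Submodule.span K {q}) ≤ 1 :=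
      (finrank_span_le_card _).trans (by simp)
    have h6 : finrank K (Fin 2 → Fin n → K) = 2 * n := by simp [Module.finrank_pi_fintype]
    rw [h.finrank_span, finrank_square] at h1
    have h7 := h1.trans (Nat.add_le_add_right h3 _)
    omega
  · have hws : w s ≠ 0 := fun h0 => hne s (by simp [h0])
    rw [LinearIndependent.pair_iff' hws] at hli
    push Not at hli
    obtain ⟨c, hc⟩ := hli
    exact hne t (by rw [← hc, mulVec_smul, hs t (Ne.symm hst), smul_zero])

theorem card_add_ne (h : TraceDual A B C) (hn : 2 ≤ n) : Fintype.card ι + n ≠ n ^ 2 + 1 := by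
  intro hk
  choose w x hB using h.exists_eq_vecMulVec hk
  obtain ⟨s₀, hker⟩ := h.exists_ker_eq_vecMulVec hk hB
  have hAB : ∀ r s, A r * B s = vecMulVec (A r *ᵥ w s) (x s) := fun r s => by
    rw [hB, mul_vecMulVec]
  have hne : ∀ r, A r *ᵥ w r ≠ 0 := fun r h0 =>
    h.mul_notMem_ker r (by rw [hAB, h0]; simp)
  have hx : ∀ s, x s ≠ 0 := fun s h0 => h.mul_notMem_ker s (by simp [hAB, h0])
  have hpar : ∀ r s, r ≠ s → A r *ᵥ w s ≠ 0 → ∃ c : K, x s = c • x s₀ := fun r s hrs h0 => by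
    obtain ⟨y, hy⟩ := hker _ (h.mul_mem_ker hrs)
    rw [hAB] at hy
    exact smul_eq_of_vecMulVec_eq h0 hy
  have hdep : ¬ LinearIndependent K w := fun hli => by
    have := hli.fintype_card_le_finrank
    rw [finrank_fintype_fun_eq_card, Fintype.card_fin] at this
    nlinarith
  rw [Fintype.not_linearIndependent_iff] at hdep
  obtain ⟨g, hg, i₀, hi₀⟩ := hdep
  -- If x_i were parallel to x_{s₀}, every A_i w_s x_iᵀ with s ≠ i would lie in N, and the relation
  -- among the w_s would put A_i B_i there too.
  have key : ∀ i, g i ≠ 0 → ¬ ∃ c : K, x i = c • x s₀ := by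
    rintro i hi ⟨c, hc⟩
    have hc0 : c ≠ 0 := by rintro rfl; exact hx i (by simpa using hc)
    have hmem : ∀ s, s ≠ i → vecMulVec (A i *ᵥ w s) (x i) ∈ LinearMap.ker (tracePairing C) := by
      intro s hs
      by_cases h0 : A i *ᵥ w s = 0
      · simp [h0]
      · obtain ⟨d, hd⟩ := hpar i s hs.symm h0
        have hd0 : d ≠ 0 := by rintro rfl; exact hx s (by simpa using hd)
        have : x i = (c / d) • x s := by rw [hd, smul_smul, div_mul_cancel₀ _ hd0, hc]
        rw [this, vecMulVec_smul, ← hAB]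
        exact Submodule.smul_mem _ _ (h.mul_mem_ker hs.symm)
    have hsum : ∑ s, g s • vecMulVec (A i *ᵥ w s) (x i) = 0 := by
      have := congrArg ((vecMulVecBilin K K).flip (x i) ∘ₗ mulVecLin (A i)) hg
      simp only [map_sum, map_smul, map_zero] at this
      exact this
    rw [← Finset.add_sum_erase _ _ (Finset.mem_univ i), ← hAB] at hsum
    refine h.mul_notMem_ker i ((Submodule.smul_mem_iff _ hi).1 ?_)
    rw [eq_neg_of_add_eq_zero_left hsum]
    exact Submodule.neg_mem _ (Submodule.sum_mem _ fun s hs =>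
      Submodule.smul_mem _ _ (hmem s (Finset.ne_of_mem_erase hs)))
  have hzero : ∀ i, g i ≠ 0 → ∀ r, r ≠ i → A r *ᵥ w i = 0 := fun i hi r hr => by
    by_contra h0
    exact key i hi (hpar r i hr h0)
  have huniq : ∀ i, i ≠ i₀ → g i = 0 := fun i hi => by
    by_contra h0
    exact hi (h.eq_of_mulVec_eq_zero hk hn hB (hzero i h0) (hzero i₀ hi₀))
  rw [Finset.sum_eq_single i₀ (fun i _ hi => by simp [huniq i hi]) (by simp)] at hg
  exact hne i₀ (by simp [(smul_eq_zero.1 hg).resolve_left hi₀])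

end TraceDual
end Matrix

end

/-! ### Bounds for GHZ restrictions -/

theorem restricts_mamu_of_le {n k l : ℕ} (hlk : l ≤ k) (h : Restricts (mamu 3 n) (ghz 3 k)) :
    Restricts (mamu 3 n) (ghz 3 l) := by
  obtain ⟨F, hF⟩ := restricts_mamu_ghz_iff.1 h
  refine restricts_mamu_ghz_iff.2
    ⟨fun j => LinearMap.funLeft ℂ ℂ (Fin.castLE hlk) ∘ₗ F j, fun p => ?_⟩
  simpa [LinearMap.funLeft_apply] using hF fun j => Fin.castLE hlk (p j)

theorem not_restricts_mamu_ghz {n k : ℕ} (hn : 2 ≤ n) (hk : n ^ 2 + 1 ≤ k + n) :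
    ¬ Restricts (mamu 3 n) (ghz 3 k) := by
  intro h
  have hle : n ≤ n ^ 2 := Nat.le_self_pow two_ne_zero n
  obtain ⟨A, B, C, hABC⟩ := exists_matrix_of_restricts
    (restricts_mamu_of_le (l := n ^ 2 + 1 - n) (by omega) h)
  refine Matrix.TraceDual.card_add_ne (A := A) (B := B) (C := C) hABC hn ?_
  rw [Fintype.card_fin]
  omega

theorem le_sq_of_restricts {n k : ℕ} (h : Restricts (mamu 3 n) (ghz 3 k)) : k ≤ n ^ 2 := by
  obtain ⟨A, B, C, hABC⟩ := exists_matrix_of_restricts h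
  simpa using Matrix.TraceDual.card_le (A := A) (B := B) (C := C) hABC

/-- Ensures that the infimum defining `bondDim` is over a nonempty set, hence attained. -/
theorem restricts_mamu_self (k : ℕ) : Restricts (mamu 3 k) (ghz 3 k) :=
  restricts_of_triangles id id id fun _ _ _ h1 h2 _ => ⟨h2, h2.symm.trans h1⟩

theorem restricts_bondDim_ghz (k : ℕ) : Restricts (mamu 3 (bondDim (ghz 3 k))) (ghz 3 k) :=
  Nat.sInf_mem (s := {D : ℕ | Restricts (mamu 3 D) (ghz 3 k)}) ⟨k, restricts_mamu_self k⟩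

theorem lt_bondDim_ghz {k : ℕ} (hk : 2 ≤ k) :
    (1 / 2 : ℝ) * (1 + Real.sqrt (4 * (k : ℝ) - 3)) < (bondDim (ghz 3 k) : ℝ) := by
  have h := restricts_bondDim_ghz k
  generalize bondDim (ghz 3 k) = D at h ⊢
  have h1 := le_sq_of_restricts h
  have hD : 2 ≤ D := by
    by_contra! hD
    interval_cases D <;> omega
  have h2 : k + D < D ^ 2 + 1 := by
    by_contra! h2
    exact not_restricts_mamu_ghz hD h2 h
  have h3 : (k : ℝ) + D ≤ (D : ℝ) ^ 2 := by exact_mod_cast Nat.lt_succ_iff.1 h2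
  have h4 : (2 : ℝ) ≤ D := by exact_mod_cast hD
  have : Real.sqrt (4 * (k : ℝ) - 3) < 2 * D - 1 := by
    rw [Real.sqrt_lt' (by linarith)]
    nlinarith
  linarith

/-- The Ruzsa–Szemerédi construction: triangles `(a, a + d, a + 2 d)` with `d` ranging over a set
without three-term arithmetic progressions. -/
theorem restricts_mamu_ghz_roth {n N : ℕ} (hN : 3 * N ≤ n) :
    Restricts (mamu 3 n) (ghz 3 (N * rothNumberNat N)) := by
  obtain ⟨S, hS, hcard, hfree⟩ := rothNumberNat_spec N
  have hSlt : ∀ d : S, (d : ℕ) < N := fun d => Finset.mem_range.1 (hS d.2)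
  let e : Fin (N * rothNumberNat N) ≃ Fin N × S :=
    finProdFinEquiv.symm.trans ((Equiv.refl _).prodCongr (S.equivFinOfCardEq hcard).symm)
  refine restricts_of_triangles
    (fun r => ⟨(e r).1, by have := (e r).1.2; omega⟩)
    (fun r => ⟨(e r).1 + (e r).2, by have := (e r).1.2; have := hSlt (e r).2; omega⟩)
    (fun r => ⟨(e r).1 + 2 * (e r).2, by have := (e r).1.2; have := hSlt (e r).2; omega⟩) ?_
  intro r s t hx hy hz
  simp only [Fin.mk.injEq] at hx hy hz
  -- The three coincidences give d_r + d_s = 2 d_t.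
  have hrs : ((e r).2 : ℕ) = (e s).2 := by
    exact threeAPFree_iff_eq_right.1 hfree (e r).2.2 (e t).2.2 (e s).2.2 (by omega)
  have hrt : ((e t).2 : ℕ) = (e r).2 := by omega
  constructor <;> refine e.injective (Prod.ext (Fin.ext ?_) (Subtype.ext ?_)) <;> omega

/-! ### Asymptotics from Behrend's bound -/

theorem Real.sq_rpow_one_sub_div_sqrt_log {x c : ℝ} (hx : 1 < x) :
    (x ^ 2) ^ (1 - c / √(log x)) = exp (2 * log x - 2 * c * √(log x)) := by
  have hL : 0 < log x := log_pos hx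
  rw [rpow_def_of_pos (by positivity), log_pow]
  congr 1
  have h : √(log x) ≠ 0 := (sqrt_pos.2 hL).ne'
  push_cast
  field_simp
  linear_combination c * sq_sqrt hL.le

theorem Real.rpow_half_add_div_sqrt_log {x c : ℝ} (hx : 1 < x) :
    x ^ (1 / 2 + c / √(log x)) = exp (log x / 2 + c * √(log x)) := by
  have hL : 0 < log x := log_pos hx
  rw [rpow_def_of_pos (by positivity)]
  congr 1
  have h : √(log x) ≠ 0 := (sqrt_pos.2 hL).ne'
  field_simp
  linear_combination -2 * c * sq_sqrt hL.le

open Real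

/-- Behrend's bound costs 4√(log n). A further 4√(log n) absorbs the factor 16 lost in ⌊n/3⌋ ≥ n/4.
-/
theorem exp_le_mul_rothNumberNat {n : ℕ} (hn : 12 ≤ n) :
    exp (2 * log n - 8 * √(log n)) ≤ ((n / 3 * rothNumberNat (n / 3) : ℕ) : ℝ) := by
  have hN : (n : ℝ) / 4 ≤ ((n / 3 : ℕ) : ℝ) := by
    rw [div_le_iff₀ (by norm_num)]
    exact_mod_cast (by omega : n ≤ n / 3 * 4)
  have hNn : ((n / 3 : ℕ) : ℝ) ≤ n := by exact_mod_cast Nat.div_le_self n 3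
  have hn' : (12 : ℝ) ≤ n := by exact_mod_cast hn
  have hN0 : (0 : ℝ) < ((n / 3 : ℕ) : ℝ) := by linarith
  have hL : 1 ≤ √(log n) := by
    rw [one_le_sqrt, le_log_iff_exp_le (by linarith)]
    linarith [exp_one_lt_d9]
  have h16 : (16 : ℝ) ≤ exp (4 * √(log n)) := by
    calc (16 : ℝ) = 2 ^ 4 := by norm_num
      _ ≤ exp 1 ^ 4 := by gcongr; linarith [exp_one_gt_d9]
      _ = exp (4 * 1) := by rw [← exp_nat_mul]; norm_num
      _ ≤ _ := by gcongr
  have hmono : exp (-4 * √(log n)) ≤ exp (-4 * √(log (n / 3 : ℕ))) := by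
    have : √(log (n / 3 : ℕ)) ≤ √(log n) := by gcongr
    gcongr exp ?_
    linarith
  calc exp (2 * log n - 8 * √(log n))
      = (n : ℝ) ^ 2 * (exp (-4 * √(log n)) / exp (4 * √(log n))) := by
        rw [← exp_sub, ← exp_log (show (0 : ℝ) < n by linarith), ← exp_nat_mul, ← exp_add,
          log_exp]
        congr 1
        push_cast
        ring
    _ ≤ (n : ℝ) ^ 2 * (exp (-4 * √(log n)) / 16) := by gcongr
    _ = (n / 4) * ((n / 4) * exp (-4 * √(log n))) := by ring
    _ ≤ (n / 3 : ℕ) * ((n / 3 : ℕ) * exp (-4 * √(log (n / 3 : ℕ)))) := by gcongr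
    _ ≤ (n / 3 : ℕ) * (rothNumberNat (n / 3) : ℝ) := by
        gcongr
        exact Behrend.roth_lower_bound
    _ = _ := by push_cast; ring

theorem restricts_mamu_ghz_of_le_exp {n k : ℕ} (hn : 12 ≤ n)
    (hk : (k : ℝ) ≤ exp (2 * log n - 8 * √(log n))) : Restricts (mamu 3 n) (ghz 3 k) :=
  restricts_mamu_of_le (by exact_mod_cast hk.trans (exp_le_mul_rothNumberNat hn))
    (restricts_mamu_ghz_roth (Nat.mul_div_le n 3))

/-- Used with s = √(log k) and y = √(log D). If y ≤ 2s, the 16s from doubling `h` covers 8y;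
otherwise y ≥ 8 and y² alone suffices. -/
theorem sq_le_two_mul_sq_sub {s y : ℝ} (hs : 4 ≤ s) (hy : 0 ≤ y)
    (h : s ^ 2 / 2 + 8 * s ≤ y ^ 2) : s ^ 2 ≤ 2 * y ^ 2 - 8 * y := by
  rcases le_total y (2 * s) with h2 | h2 <;> nlinarith

theorem bondDim_ghz_le {k : ℕ} (hk : 16 ≤ log k) :
    (bondDim (ghz 3 k) : ℝ) ≤ 2 * exp (log k / 2 + 8 * √(log k)) := by
  set s := √(log k) with hs
  have hs4 : 4 ≤ s := le_sqrt_of_sq_le (by norm_num [hk])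
  have hs2 : s ^ 2 = log k := sq_sqrt (by linarith)
  have hk0 : (0 : ℝ) < k := by
    rcases Nat.eq_zero_or_pos k with rfl | h
    · norm_num at hk
    · exact_mod_cast h
  set D := ⌈exp (log k / 2 + 8 * s)⌉₊ with hD
  have hle : exp (log k / 2 + 8 * s) ≤ D := Nat.le_ceil _
  have h32 : log k / 2 + 8 * s + 1 ≤ D := (add_one_le_exp _).trans hle
  have hD12 : 12 ≤ D := by
    have : (12 : ℝ) ≤ D := by linarith
    exact_mod_cast this
  have hlog : log k / 2 + 8 * s ≤ log D := (le_log_iff_exp_le (by linarith)).2 hle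
  have hy : √(log D) ^ 2 = log D := sq_sqrt (by linarith)
  have hres : Restricts (mamu 3 D) (ghz 3 k) := by
    refine restricts_mamu_ghz_of_le_exp hD12 ?_
    rw [← log_le_iff_le_exp hk0, ← hs2, ← hy, sqrt_sq (sqrt_nonneg _)]
    exact sq_le_two_mul_sq_sub hs4 (sqrt_nonneg _) (by rw [hy, hs2]; exact hlog)
  have h1 : bondDim (ghz 3 k) ≤ D := Nat.sInf_le hres
  have h2 : (bondDim (ghz 3 k) : ℝ) ≤ D := by exact_mod_cast h1
  have h3 : (D : ℝ) < exp (log k / 2 + 8 * s) + 1 := Nat.ceil_lt_add_one (exp_pos _).le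
  have h4 : 1 ≤ exp (log k / 2 + 8 * s) := one_le_exp (by linarith)
  linarith

theorem eventually_le_log_natCast (c : ℝ) : ∀ᶠ n : ℕ in Filter.atTop, c ≤ log n :=
  (tendsto_log_atTop.comp tendsto_natCast_atTop_atTop).eventually_ge_atTop c

theorem isTheta_floor_of_eventually_one_le {g : ℕ → ℝ} {f : ℕ → ℕ}
    (hf : ∀ᶠ n in Filter.atTop, f n = ⌊g n⌋₊) (hg : ∀ᶠ n in Filter.atTop, 1 ≤ g n) :
    Asymptotics.IsTheta Filter.atTop (fun n => (f n : ℝ)) g := by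
  constructor
  · refine Asymptotics.IsBigO.of_bound 1 ?_
    filter_upwards [hf, hg] with n hn h1
    rw [hn, one_mul, norm_of_nonneg (by positivity), norm_of_nonneg (by linarith)]
    exact Nat.floor_le (by linarith)
  · refine Asymptotics.IsBigO.of_bound 2 ?_
    filter_upwards [hf, hg] with n hn h1
    rw [hn, norm_of_nonneg (by linarith), norm_of_nonneg (by positivity)]
    have h2 := Nat.lt_floor_add_one (g n)
    have h3 : (1 : ℝ) ≤ ⌊g n⌋₊ := by exact_mod_cast Nat.one_le_floor_iff _ |>.2 h1
    linarith

theorem mainTheorem2 :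
    (∀ k : ℕ, 2 ≤ k → (1 / 2 : ℝ) * (1 + Real.sqrt (4 * (k : ℝ) - 3)) < (bondDim (ghz 3 k) : ℝ)) ∧
    (∃ c : ℝ, 0 < c ∧
      Asymptotics.IsBigO Filter.atTop (fun k : ℕ => (bondDim (ghz 3 k) : ℝ))
        (fun k : ℕ => (k : ℝ) ^ (1 / 2 + c / Real.sqrt (Real.log (k : ℝ))))) ∧
    (∀ n : ℕ, 2 ≤ n → ¬ Restricts (mamu 3 n) (ghz 3 (n ^ 2 - n + 1))) ∧
    (∃ c' : ℝ, 0 < c' ∧ ∃ f : ℕ → ℕ,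
      (∀ n : ℕ, 1 ≤ n → Restricts (mamu 3 n) (ghz 3 (f n))) ∧
      Asymptotics.IsTheta Filter.atTop (fun n : ℕ => (f n : ℝ))
        (fun n : ℕ => ((n : ℝ) ^ 2) ^ (1 - c' / Real.sqrt (Real.log (n : ℝ))))) := by
  -- The constant 4 in the exponent becomes 8 since log (n²) = 2 log n. Below 12 the value 0 is
  -- harmless, as only large n affect the asymptotics.
  refine ⟨fun k hk => lt_bondDim_ghz hk, ⟨8, by norm_num, ?_⟩,
    fun n hn => not_restricts_mamu_ghz hn (by omega), 4, by norm_num,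
    fun n => if 12 ≤ n then ⌊((n : ℝ) ^ 2) ^ (1 - 4 / √(log n))⌋₊ else 0, fun n _ => ?_,
    isTheta_floor_of_eventually_one_le ?_ ?_⟩
  · refine Asymptotics.IsBigO.of_bound 2 ?_
    filter_upwards [eventually_le_log_natCast 16, Filter.eventually_gt_atTop 1] with k hk hk1
    rw [rpow_half_add_div_sqrt_log (by exact_mod_cast hk1), norm_of_nonneg (by positivity),
      norm_of_nonneg (by positivity)]
    exact bondDim_ghz_le hk
  · by_cases hn : 12 ≤ n
    · refine restricts_mamu_ghz_of_le_exp hn ?_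
      dsimp only
      rw [if_pos hn]
      refine (Nat.floor_le (by positivity)).trans ?_
      rw [sq_rpow_one_sub_div_sqrt_log (by exact_mod_cast (by omega : 1 < n))]
      norm_num
    · exact restricts_mamu_of_le (by simp [hn]) (restricts_mamu_self n)
  · filter_upwards [Filter.eventually_ge_atTop 12] with n hn using if_pos hn
  · filter_upwards [eventually_le_log_natCast 16, Filter.eventually_gt_atTop 1] with n hn hn1
    rw [sq_rpow_one_sub_div_sqrt_log (by exact_mod_cast hn1)]
    have h4 : 4 ≤ √(log n) := le_sqrt_of_sq_le (by norm_num [hn])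
    have h2 : √(log n) ^ 2 = log n := sq_sqrt (by linarith)
    exact one_le_exp (by nlinarith)
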